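/- Let $n \ge 1$ be an integer and let $k$ be a field with $\operatorname{char} k \neq 2$ and $\operatorname{char} k \nmid 1+(-2)^n$ (where, if $\operatorname{char} k = 0$, the second condition means $1+(-2)^n \neq 0$). Let $R = k[[x,y]]/(xy(x^n+y^n))$, a local ring with maximal ideal $\mathfrak m = (x,y)R$. Then $$\mathfrak m^{n+2} = (x+2y)\,\mathfrak m^{n+1} \qquad\text{and}\qquad \mathrm{g}\ell\ell(R) = \mathrm{index}(R) = n+2 .$$ Here $\mathrm{g}\ell\ell(R)$, the generalized Loewy length, is the smallest integer $j \ge 1$ such that $\mathfrak m^j$ is contained in the ideal generated by some system of parameters of $R$. For a finitely generated $R$-module $M$, Auslander's invariant $\delta_R(M)$ is the smallest integer $r \ge 0$ for which there is a surjective $R$-linear map $X \oplus R^r \to M$, where $X$ is a maximal Cohen–Macaulay $R$-module ($X = 0$ allowed) without nonzero free direct summand. Finally, $\mathrm{index}(R) = \inf\{\, j \ge 1 : \delta_R(R/\mathfrak m^j) = 1 \,\}$. -/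

import Mathlib

open IsLocalRing

universe u v

section Invariants

/-- `X` is a maximal Cohen-Macaulay module over the local ring `R`: it is finitely generated and,
unless it is zero (the zero module is allowed, as is usual for Auslander's delta invariant), there
is an `X`-regular sequence in the maximal ideal whose length is the Krull dimension of `R`.
(As the depth of a nonzero finitely generated module over a Noetherian local ring is at most
the dimension of the ring, this says that the depth of `X` is the dimension of `R`.) -/
def IsMaximalCohenMacaulay (R : Type u) [CommRing R] [IsLocalRing R]
    (X : Type v) [AddCommGroup X] [Module R X] : Prop :=
  Module.Finite R X ∧
    (Subsingleton X ∨
      ∃ rs : List R, (∀ r ∈ rs, r ∈ maximalIdeal R) ∧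
        RingTheory.Sequence.IsRegular X rs ∧
        ((rs.length : ℕ) : WithBot ℕ∞) = ringKrullDim R)

/-- The module `X` has no nonzero free direct summand. -/
def HasNoFreeSummand (R : Type u) [CommRing R]
    (X : Type v) [AddCommGroup X] [Module R X] : Prop :=
  ∀ N N' : Submodule R X, IsCompl N N' → Module.Free R N → N = ⊥

/-- Auslander's delta invariant of a finitely generated module `M` over a local ring `R`: the
smallest `n` for which there is a surjection `X ⊕ R ^ n → M` with `X` maximal Cohen-Macaulay
without nonzero free direct summand. (For finitely generated `M` such an `n` exists, by
taking `X = 0`.) -/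
noncomputable def auslanderDelta (R : Type u) [CommRing R] [IsLocalRing R]
    (M : Type v) [AddCommGroup M] [Module R M] : ℕ :=
  sInf {n : ℕ | ∃ (X : Type u) (_ : AddCommGroup X) (_ : Module R X),
    IsMaximalCohenMacaulay R X ∧ HasNoFreeSummand R X ∧
      ∃ φ : (X × (Fin n → R)) →ₗ[R] M, Function.Surjective φ}

/-- Auslander's index of a local ring `R` with maximal ideal `m`: the infimum of all `n ≥ 1`
for which the delta invariant of `R / m ^ n` is `1` (it is `⊤` if there is no such `n`). -/
noncomputable def auslanderIndex (R : Type u) [CommRing R] [IsLocalRing R] : ℕ∞ :=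
  ⨅ (n : ℕ) (_ : 1 ≤ n ∧ auslanderDelta R (R ⧸ maximalIdeal R ^ n) = 1), (n : ℕ∞)

/-- `x₁, …, x_d` is a system of parameters of the local ring `R`: `d` is the Krull dimension of
`R`, and `x₁, …, x_d` generate an ideal whose radical is the maximal ideal. -/
def IsSystemOfParameters (R : Type u) [CommRing R] [IsLocalRing R]
    {d : ℕ} (x : Fin d → R) : Prop :=
  (d : WithBot ℕ∞) = ringKrullDim R ∧
    (Ideal.span (Set.range x)).radical = maximalIdeal R

/-- The generalized Loewy length of a local ring `R` with maximal ideal `m`: the smallest `n ≥ 1`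
for which `m ^ n` is contained in the ideal generated by some system of parameters
(it is `⊤` if there is no such `n`). -/
noncomputable def generalizedLoewyLength (R : Type u) [CommRing R] [IsLocalRing R] : ℕ∞ :=
  ⨅ (n : ℕ) (_ : 1 ≤ n ∧ ∃ (d : ℕ) (x : Fin d → R), IsSystemOfParameters R x ∧
    maximalIdeal R ^ n ≤ Ideal.span (Set.range x)), (n : ℕ∞)

end Invariants

section Ring

/-- The power series `xy(xⁿ + yⁿ)` in `k⟦x, y⟧`, where `x = X 0` and `y = X 1`. -/
noncomputable def defPoly (k : Type u) [Field k] (n : ℕ) : MvPowerSeries (Fin 2) k :=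
  MvPowerSeries.X 0 * MvPowerSeries.X 1 * (MvPowerSeries.X 0 ^ n + MvPowerSeries.X 1 ^ n)

/-- The ring `k⟦x, y⟧ / (xy(xⁿ + yⁿ))`. -/
abbrev HypersurfaceRing (k : Type u) [Field k] (n : ℕ) : Type u :=
  MvPowerSeries (Fin 2) k ⧸ Ideal.span {defPoly k n}

instance hypersurfaceRing_nontrivial (k : Type u) [Field k] (n : ℕ) :
    Nontrivial (HypersurfaceRing k n) := by
  refine Ideal.Quotient.nontrivial_iff.mpr fun h => ?_
  rw [Ideal.span_singleton_eq_top] at h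
  have h2 := h.map (MvPowerSeries.constantCoeff (σ := Fin 2) (R := k))
  simp [defPoly] at h2

instance hypersurfaceRing_isLocalRing (k : Type u) [Field k] (n : ℕ) :
    IsLocalRing (HypersurfaceRing k n) :=
  IsLocalRing.of_surjective' (Ideal.Quotient.mk (Ideal.span {defPoly k n}))
    Ideal.Quotient.mk_surjective

/-- The image of `x` in `k⟦x, y⟧ / (xy(xⁿ + yⁿ))`. -/
noncomputable def xBar (k : Type u) [Field k] (n : ℕ) : HypersurfaceRing k n :=
  Ideal.Quotient.mk _ (MvPowerSeries.X 0)

/-- The image of `y` in `k⟦x, y⟧ / (xy(xⁿ + yⁿ))`. -/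
noncomputable def yBar (k : Type u) [Field k] (n : ℕ) : HypersurfaceRing k n :=
  Ideal.Quotient.mk _ (MvPowerSeries.X 1)

end Ring

/-! Write `l = x + 2y` and `f = xy(xⁿ + yⁿ)`. Modulo `l`, `x = -2y` turns `f` into `-2((-2)ⁿ + 1)
yⁿ⁺²`, whose coefficient is invertible in `k`; as `m = (l, y)`, this gives `mⁿ⁺² = l mⁿ⁺¹`, so `l`
is a parameter with `mⁿ⁺² ⊆ (l)`.

No `z` in `m` satisfies `mⁿ⁺¹ ⊆ (z)` (`not_maximalIdeal_pow_le_span_singleton`): a lift of `z` would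
divide `xⁿ⁺¹` and `yⁿ⁺¹` modulo `f`, and comparing lowest weights forces it to be a unit. This
settles the Loewy length.

For `j ≤ n + 1`, the maximal Cohen–Macaulay module `R/(y(xⁿ + yⁿ))` maps onto `R/mʲ`, so delta
vanishes. For `j = n + 2`, let a maximal Cohen–Macaulay `X` map onto `R/mⁿ⁺²` with `e ↦ 1`. Over `A
= k⟦t⟧`, `t ↦ l`, `X` is finite free, and `yⁿ⁺¹ e ∉ lX`, as otherwise `mⁿ⁺¹ ⊆ (l)`. Hence some
`A`-coordinate of `yⁿ⁺¹ e` is a unit. Duality over `A` (`exists_linearMap_eq_sum`) turns this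
coordinate into an `R`-linear form that is a unit at `e`, which splits off a copy of `R`. -/

/-! ### Algebras spanned by powers of one element: completeness and duality. -/

theorem SModEq.span_singleton_pow_iff {A M : Type*} [CommRing A] [AddCommGroup M] [Module A M]
    {t : A} {m : ℕ} {a b : M} :
    a ≡ b [SMOD (Ideal.span {t} ^ m • ⊤ : Submodule A M)] ↔ ∃ c : M, t ^ m • c = a - b := by
  rw [SModEq.sub_mem, Ideal.span_singleton_pow, Submodule.ideal_span_singleton_smul,
    Submodule.mem_smul_pointwise_iff_exists]
  simp

/-- For a principal ideal, congruence modulo its `m`-th power is divisibility by `t ^ m`, which can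
be tested coordinatewise even when `ι` is infinite. -/
theorem IsPrecomplete.pi_of_span_singleton {A : Type*} [CommRing A] {ι : Type*} (t : A)
    [IsPrecomplete (Ideal.span {t}) A] : IsPrecomplete (Ideal.span {t}) (ι → A) where
  prec' f hf := by
    have hco : ∀ i, ∃ L : A, ∀ m, f m i ≡ L [SMOD (Ideal.span {t} ^ m • ⊤ : Submodule A A)] := by
      intro i
      refine IsPrecomplete.prec' (fun m => f m i) fun {m p} hmp => ?_
      obtain ⟨c, hc⟩ := SModEq.span_singleton_pow_iff.1 (hf hmp)
      exact SModEq.span_singleton_pow_iff.2 ⟨c i, by simpa using congrFun hc i⟩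
    choose L hL using hco
    refine ⟨L, fun m => SModEq.span_singleton_pow_iff.2 ?_⟩
    choose c hc using fun i => SModEq.span_singleton_pow_iff.1 (hL i m)
    exact ⟨c, funext fun i => by simpa using hc i⟩

/-- If the powers `1, y, …, y ^ (N - 1)` span an algebra modulo `t`, then they span it, provided that
the base ring is `t`-adically complete and the algebra is `t`-adically separated. -/
theorem exists_eq_sum_smul_pow_of_mod {A R : Type*} [CommRing A] [CommRing R] [Algebra A R] (t : A)
    [IsPrecomplete (Ideal.span {t}) A] [IsHausdorff (Ideal.span {t}) R] (y : R) (N : ℕ)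
    (h : ∀ r : R, ∃ (c : Fin N → A) (s : R), r = ∑ i, c i • y ^ (i : ℕ) + t • s) (r : R) :
    ∃ c : Fin N → A, r = ∑ i, c i • y ^ (i : ℕ) := by
  have := IsPrecomplete.pi_of_span_singleton (ι := Fin N) t
  have hsurj : Function.Surjective (Fintype.linearCombination A fun i : Fin N => y ^ (i : ℕ)) := by
    refine surjective_of_mkQ_comp_surjective (I := Ideal.span {t}) fun q => ?_
    obtain ⟨r, rfl⟩ := Submodule.mkQ_surjective _ q
    obtain ⟨c, s, hr⟩ := h r
    refine ⟨c, ?_⟩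
    rw [LinearMap.comp_apply, Submodule.mkQ_apply, Submodule.mkQ_apply, eq_comm,
      Submodule.Quotient.eq, Fintype.linearCombination_apply, hr, add_sub_cancel_left]
    exact Submodule.smul_mem_smul (Ideal.mem_span_singleton_self t) trivial
  obtain ⟨c, hc⟩ := hsurj r
  exact ⟨c, by rw [← hc, Fintype.linearCombination_apply]⟩

/-- Let `R` be spanned over `A` by the powers of `y`, and let `g 0 = 0`, `g N = 1` and
`y * g (i + 1) = g i + c i`. Then every `A`-linear form `ψ` on an `R`-module induces the `R`-linear
form `v ↦ ∑ i < N, ψ (g (i + 1) v) y ^ i`. -/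
theorem exists_linearMap_eq_sum {A R X : Type*} [CommRing A] [CommRing R] [Algebra A R]
    [AddCommGroup X] [Module R X] [Module A X] [IsScalarTower A R X] (y : R) (N : ℕ)
    (c : ℕ → A) (g : ℕ → R) (h0 : g 0 = 0) (hN : g N = 1)
    (hg : ∀ i < N, y * g (i + 1) = g i + algebraMap A R (c i))
    (hy : y ^ N = ∑ i ∈ Finset.range N, c i • y ^ i)
    (hspan : ∀ r : R, ∃ c : Fin N → A, r = ∑ i, c i • y ^ (i : ℕ)) (ψ : X →ₗ[A] A) :
    ∃ Φ : X →ₗ[R] R, ∀ v, Φ v = ∑ i ∈ Finset.range N, ψ (g (i + 1) • v) • y ^ i := by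
  let F : X →ₗ[A] R :=
    ∑ i ∈ Finset.range N, ((LinearMap.toSpanSingleton A R (y ^ i)).comp
      (ψ.comp ((LinearMap.lsmul R X (g (i + 1))).restrictScalars A)))
  have hF : ∀ v, F v = ∑ i ∈ Finset.range N, ψ (g (i + 1) • v) • y ^ i := by
    intro v
    simp [F, LinearMap.sum_apply]
  have hFy : ∀ v, F (y • v) = y * F v := by
    intro v
    have e1 : ∀ i ∈ Finset.range N, ψ (g (i + 1) • y • v) • y ^ i
        = ψ (g i • v) • y ^ i + ψ v • (c i • y ^ i) := by
      intro i hi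
      rw [smul_smul, mul_comm, hg i (Finset.mem_range.1 hi), add_smul, algebraMap_smul, map_add,
        map_smul ψ (c i), add_smul, smul_smul, smul_eq_mul, mul_comm (ψ v)]
    -- The sum over `i ≤ N` is split at both ends: `g N = 1` makes the top term `ψ v • y ^ N`, and
    -- `g 0 = 0` kills the bottom one, leaving `y * F v`.
    have e2 := Finset.sum_range_succ (fun i => ψ (g i • v) • y ^ i) N
    rw [Finset.sum_range_succ'] at e2
    rw [hF, hF, Finset.sum_congr rfl e1, Finset.sum_add_distrib, ← Finset.smul_sum, ← hy,
      Finset.mul_sum]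
    simp only [hN, h0, one_smul, zero_smul, map_zero, add_zero] at e2
    rw [← e2]
    refine Finset.sum_congr rfl fun i _ => ?_
    rw [pow_succ', mul_smul_comm]
  have hFpow : ∀ (j : ℕ) v, F (y ^ j • v) = y ^ j * F v := by
    intro j
    induction j with
    | zero => simp
    | succ j ih => intro v; rw [pow_succ', mul_smul, hFy, ih, mul_assoc]
  refine ⟨{ toFun := F, map_add' := map_add F, map_smul' := fun r v => ?_ }, hF⟩
  obtain ⟨a, rfl⟩ := hspan r
  simp only [Finset.sum_smul, map_sum, smul_assoc, map_smul, hFpow, RingHom.id_apply, smul_eq_mul,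
    Finset.sum_mul, smul_mul_assoc]

/-! ### Criteria for free direct summands. -/

/-- A surjection onto a nontrivial ring gives a nonzero free direct summand. -/
theorem not_hasNoFreeSummand_of_surjective {R : Type u} [CommRing R] [Nontrivial R]
    {X : Type v} [AddCommGroup X] [Module R X] (Φ : X →ₗ[R] R) (hΦ : Function.Surjective Φ) :
    ¬ HasNoFreeSummand R X := by
  intro h
  obtain ⟨s, hs⟩ := LinearMap.exists_rightInverse_of_surjective Φ (LinearMap.range_eq_top.2 hΦ)
  have hs' : ∀ r, Φ (s r) = r := fun r => LinearMap.congr_fun hs r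
  have hinj : Function.Injective s := fun a b hab => by rw [← hs' a, hab, hs']
  have hc : IsCompl (LinearMap.range s) (LinearMap.ker Φ) := by
    refine ⟨Submodule.disjoint_def.2 ?_, codisjoint_iff.2 (eq_top_iff.2 fun v _ => ?_)⟩
    · rintro _ ⟨r, rfl⟩ hr
      rw [LinearMap.mem_ker, hs'] at hr
      rw [hr, map_zero]
    · refine Submodule.mem_sup.2 ⟨s (Φ v), ⟨_, rfl⟩, v - s (Φ v), ?_, by abel⟩
      rw [LinearMap.mem_ker, map_sub, hs', sub_self]
  have hfree : Module.Free R (LinearMap.range s) :=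
    Module.Free.of_equiv (LinearEquiv.ofInjective s hinj)
  have hb := h _ _ hc hfree
  have h1 : s 1 = 0 := by
    have : s 1 ∈ LinearMap.range s := ⟨1, rfl⟩
    rwa [hb, Submodule.mem_bot] at this
  exact one_ne_zero (α := R) (by rw [← hs' 1, h1, map_zero])

/-- A module killed by a nonzero element of the ring has no nonzero free direct summand. -/
theorem hasNoFreeSummand_of_smul_eq_zero {R : Type u} [CommRing R] {X : Type v} [AddCommGroup X]
    [Module R X] {a : R} (ha : a ≠ 0) (h : ∀ v : X, a • v = 0) : HasNoFreeSummand R X := by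
  intro N _ _ hN
  let b := Module.Free.chooseBasis R N
  rcases isEmpty_or_nonempty (Module.Free.ChooseBasisIndex R N) with hE | ⟨⟨i⟩⟩
  · have := b.repr.toEquiv.subsingleton
    exact Submodule.eq_bot_of_subsingleton
  · refine absurd ?_ ha
    have h1 : a • b i = 0 := Subtype.ext (h (b i))
    have h2 := congrArg (fun w => b.repr w i) h1
    simpa using h2

/-! ### Powers of ideals, and power series without constant term. -/

theorem exists_mem_pow_pow_sub_pow {R : Type*} [CommRing R] (I : Ideal R) {a b : R} (ha : a ∈ I)
    (hb : b ∈ I) (n : ℕ) : ∃ q ∈ I ^ n, a ^ (n + 1) - b ^ (n + 1) = (a - b) * q := by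
  refine ⟨∑ i ∈ Finset.range (n + 1), a ^ i * b ^ (n + 1 - 1 - i), Ideal.sum_mem _ fun i hi => ?_, ?_⟩
  · have h := Ideal.mul_mem_mul (Ideal.pow_mem_pow ha i) (Ideal.pow_mem_pow hb (n + 1 - 1 - i))
    rwa [← pow_add, show i + (n + 1 - 1 - i) = n by
      have := Finset.mem_range.1 hi; omega] at h
  · rw [mul_comm, (Commute.all a b).geom_sum₂_mul]

/-- Every monomial of degree `j + 1` in `a, b` except `b ^ (j + 1)` contains `a`. Thus only the pure
power of `y` needs checking when `a = l` and `b = y`. -/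
theorem span_pair_pow_succ_le {R : Type*} [CommRing R] (a b : R) (j : ℕ) :
    Ideal.span {a, b} ^ (j + 1) ≤
      Ideal.span {a} * Ideal.span {a, b} ^ j ⊔ Ideal.span {b ^ (j + 1)} := by
  induction j with
  | zero => simp [← Ideal.span_insert]
  | succ j ih =>
    have hsp : Ideal.span {a, b} = Ideal.span {a} ⊔ Ideal.span {b} := Ideal.span_insert _ _
    have hb : Ideal.span {b} * Ideal.span {a, b} ^ (j + 1) ≤
        Ideal.span {a} * Ideal.span {a, b} ^ (j + 1) ⊔ Ideal.span {b ^ (j + 1 + 1)} := by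
      refine (Ideal.mul_mono_right ih).trans ?_
      rw [Ideal.mul_sup, Ideal.span_singleton_mul_span_singleton, ← pow_succ', mul_left_comm]
      refine sup_le_sup_right (Ideal.mul_mono_right ?_) _
      rw [pow_succ']
      exact Ideal.mul_mono_left (Ideal.span_mono (by simp))
    rw [pow_succ' _ (j + 1)]
    nth_rw 1 [hsp]
    rw [Ideal.sup_mul]
    exact sup_le le_sup_left hb

theorem MvPowerSeries.exists_eq_X_mul_add_X_mul {k : Type*} [Field k]
    (p : MvPowerSeries (Fin 2) k) (hp : MvPowerSeries.constantCoeff p = 0) :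
    ∃ a b, p = MvPowerSeries.X 0 * a + MvPowerSeries.X 1 * b := by
  classical
  -- `q` is the part of `p` free of `X 0`; without constant term it is divisible by `X 1`.
  let q : MvPowerSeries (Fin 2) k := fun d => if d 0 = 0 then MvPowerSeries.coeff d p else 0
  have hq : ∀ d, MvPowerSeries.coeff d q = if d 0 = 0 then MvPowerSeries.coeff d p else 0 :=
    fun d => rfl
  obtain ⟨a, ha⟩ : (MvPowerSeries.X 0 : MvPowerSeries (Fin 2) k) ∣ p - q := by
    rw [MvPowerSeries.X_dvd_iff]
    intro d hd
    rw [map_sub, hq, if_pos hd, sub_self]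
  obtain ⟨b, hb⟩ : (MvPowerSeries.X 1 : MvPowerSeries (Fin 2) k) ∣ q := by
    rw [MvPowerSeries.X_dvd_iff]
    intro d hd
    rw [hq]
    split_ifs with h0
    · have : d = 0 := by ext i; fin_cases i <;> simpa
      rw [this, MvPowerSeries.coeff_zero_eq_constantCoeff_apply, hp]
    · rfl
  exact ⟨a, b, by rw [← ha, ← hb]; ring⟩

/-! ### The maximal ideal and its reduction by `x + 2y`. -/

section HypersurfaceRing

variable (k : Type u) [Field k] (n : ℕ)

theorem mk_mem_maximalIdeal_iff (p : MvPowerSeries (Fin 2) k) :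
    (Ideal.Quotient.mk _ p : HypersurfaceRing k n) ∈ maximalIdeal (HypersurfaceRing k n) ↔
      MvPowerSeries.constantCoeff p = 0 := by
  have hf : MvPowerSeries.constantCoeff (defPoly k n) = 0 := by simp [defPoly]
  rw [mem_maximalIdeal, mem_nonunits_iff, ← not_iff_not, not_not]
  change _ ↔ MvPowerSeries.constantCoeff p ≠ 0
  rw [← isUnit_iff_ne_zero, ← MvPowerSeries.isUnit_iff_constantCoeff]
  refine ⟨fun h => ?_, fun h => h.map _⟩
  obtain ⟨r, hr⟩ := h.exists_right_inv
  obtain ⟨q, rfl⟩ := Ideal.Quotient.mk_surjective r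
  rw [← map_mul, ← map_one (Ideal.Quotient.mk _), Ideal.Quotient.eq,
    Ideal.mem_span_singleton] at hr
  have h1 := map_dvd (MvPowerSeries.constantCoeff (σ := Fin 2) (R := k)) hr
  rw [hf, zero_dvd_iff, map_sub, map_mul, map_one, sub_eq_zero] at h1
  rw [MvPowerSeries.isUnit_iff_constantCoeff]
  exact IsUnit.of_mul_eq_one _ h1

theorem maximalIdeal_eq_span :
    maximalIdeal (HypersurfaceRing k n) = Ideal.span {xBar k n, yBar k n} := by
  apply le_antisymm
  · intro r hr
    obtain ⟨p, rfl⟩ := Ideal.Quotient.mk_surjective r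
    obtain ⟨a, b, rfl⟩ :=
      MvPowerSeries.exists_eq_X_mul_add_X_mul p ((mk_mem_maximalIdeal_iff k n p).1 hr)
    rw [Ideal.mem_span_pair]
    exact ⟨Ideal.Quotient.mk _ a, Ideal.Quotient.mk _ b, by
      rw [xBar, yBar, map_add, map_mul, map_mul]; ring⟩
  · rw [Ideal.span_le]
    rintro r (rfl | rfl)
    · exact (mk_mem_maximalIdeal_iff k n _).2 (by simp)
    · exact (mk_mem_maximalIdeal_iff k n _).2 (by simp)

theorem xBar_mem : xBar k n ∈ maximalIdeal (HypersurfaceRing k n) :=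
  (mk_mem_maximalIdeal_iff k n _).2 (by simp)

theorem yBar_mem : yBar k n ∈ maximalIdeal (HypersurfaceRing k n) :=
  (mk_mem_maximalIdeal_iff k n _).2 (by simp)

theorem xBar_add_two_mul_yBar_mem :
    xBar k n + 2 * yBar k n ∈ maximalIdeal (HypersurfaceRing k n) :=
  add_mem (xBar_mem k n) (Ideal.mul_mem_left _ _ (yBar_mem k n))

theorem maximalIdeal_eq_span' :
    maximalIdeal (HypersurfaceRing k n) = Ideal.span {xBar k n + 2 * yBar k n, yBar k n} := by
  rw [maximalIdeal_eq_span]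
  apply le_antisymm <;> rw [Ideal.span_le] <;> rintro r (rfl | rfl)
  · exact Ideal.mem_span_pair.2 ⟨1, -2, by ring⟩
  · exact Ideal.subset_span (by simp)
  · exact Ideal.mem_span_pair.2 ⟨1, 2, by ring⟩
  · exact Ideal.subset_span (by simp)

theorem xBar_mul_yBar_mul : xBar k n * (yBar k n * (xBar k n ^ n + yBar k n ^ n)) = 0 := by
  refine Ideal.Quotient.eq_zero_iff_mem.2 (Ideal.mem_span_singleton.2 ⟨1, ?_⟩)
  rw [defPoly]
  ring

variable {k n}

theorem leading_coeff_ne_zero (h2 : ringChar k ≠ 2)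
    (hchar : ¬ ((ringChar k : ℤ) ∣ 1 + (-2) ^ n)) : (-2 : k) * ((-2) ^ n + 1) ≠ 0 := by
  refine mul_ne_zero (neg_ne_zero.2 (Ring.two_ne_zero h2)) fun h => hchar ?_
  rw [← CharP.intCast_eq_zero_iff k]
  push_cast
  rw [add_comm, h]

theorem yBar_pow_mem (h2 : ringChar k ≠ 2) (hchar : ¬ ((ringChar k : ℤ) ∣ 1 + (-2) ^ n)) :
    yBar k n ^ (n + 2) ∈ Ideal.span {xBar k n + 2 * yBar k n} *
      maximalIdeal (HypersurfaceRing k n) ^ (n + 1) := by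
  have hx := xBar_mem k n
  have hy := yBar_mem k n
  have h0 := xBar_mul_yBar_mul k n
  have hc := leading_coeff_ne_zero h2 hchar
  set x := xBar k n
  set y := yBar k n
  -- Keeping the cofactor `q` in `mⁿ` gives membership in `l mⁿ⁺¹` rather than just in `(l)`.
  obtain ⟨q, hq, h⟩ := exists_mem_pow_pow_sub_pow _ hx
    (Ideal.mul_mem_left _ (-2) hy) n
  have hmem : y * (q + y ^ n) ∈ maximalIdeal (HypersurfaceRing k n) ^ (n + 1) := by
    rw [pow_succ']
    exact Ideal.mul_mem_mul hy (add_mem hq (Ideal.pow_mem_pow hy n))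
  have hmem2 := Ideal.mul_mem_mul (Ideal.mem_span_singleton_self (x + 2 * y)) hmem
  have e : (x + 2 * y) * (y * (q + y ^ n)) =
      -((-2) * ((-2) ^ n + 1) * y ^ (n + 2)) := by
    have : (x + 2 * y) * q = x ^ (n + 1) - (-2 * y) ^ (n + 1) := by rw [h]; ring
    calc (x + 2 * y) * (y * (q + y ^ n)) = y * ((x + 2 * y) * q) + (x + 2 * y) * y ^ (n + 1) := by
          ring
      _ = x * (y * (x ^ n + y ^ n)) + (-((-2) * ((-2) ^ n + 1) * y ^ (n + 2))) := by
          rw [this, mul_pow]; ring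
      _ = _ := by rw [h0, zero_add]
  have hu : (-2 : HypersurfaceRing k n) * ((-2) ^ n + 1) =
      algebraMap k (HypersurfaceRing k n) ((-2 : k) * ((-2) ^ n + 1)) := by
    rw [map_mul, map_add, map_pow, map_neg, map_ofNat, map_one]
  rw [e, neg_mem_iff, hu] at hmem2
  have := Ideal.mul_mem_left _ (algebraMap k (HypersurfaceRing k n) ((-2 : k) * ((-2) ^ n + 1))⁻¹)
    hmem2
  rwa [← mul_assoc, ← map_mul, inv_mul_cancel₀ hc, map_one, one_mul] at this

theorem maximalIdeal_pow_eq (h2 : ringChar k ≠ 2)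
    (hchar : ¬ ((ringChar k : ℤ) ∣ 1 + (-2) ^ n)) :
    maximalIdeal (HypersurfaceRing k n) ^ (n + 2) =
      Ideal.span {xBar k n + 2 * yBar k n} * maximalIdeal (HypersurfaceRing k n) ^ (n + 1) := by
  apply le_antisymm
  · have h := span_pair_pow_succ_le (xBar k n + 2 * yBar k n) (yBar k n) (n + 1)
    rw [← maximalIdeal_eq_span'] at h
    refine h.trans (sup_le le_rfl ?_)
    rw [Ideal.span_singleton_le_iff_mem]
    exact yBar_pow_mem h2 hchar
  · rw [pow_succ' _ (n + 1)]
    refine Ideal.mul_mono_left ?_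
    rw [Ideal.span_singleton_le_iff_mem]
    exact xBar_add_two_mul_yBar_mem k n

/-! ### Weighted orders and the lower bound for parameters. -/

theorem MvPowerSeries.exists_coeff_ne_zero_of_weightedOrder_eq {σ R : Type*} [Semiring R]
    {w : σ → ℕ} {f : MvPowerSeries σ R} {m : ℕ} (h : MvPowerSeries.weightedOrder w f = m) :
    ∃ d, MvPowerSeries.coeff d f ≠ 0 ∧ Finsupp.weight w d = m :=
  ((MvPowerSeries.weightedOrder_eq_nat w).1 h).1

theorem weight_fin_two (p q : ℕ) (d : Fin 2 →₀ ℕ) :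
    Finsupp.weight ![p, q] d = d 0 * p + d 1 * q := by
  rw [Finsupp.weight_apply, Finsupp.sum_fintype _ _ (by simp)]
  simp [Fin.sum_univ_two]

theorem MvPowerSeries.weightedOrder_X_pow {σ R : Type*} [Semiring R] [Nontrivial R]
    (w : σ → ℕ) (i : σ) (m : ℕ) :
    MvPowerSeries.weightedOrder w (MvPowerSeries.X i ^ m : MvPowerSeries σ R) = (m * w i : ℕ) := by
  rw [MvPowerSeries.X_pow_eq, MvPowerSeries.weightedOrder_monomial_of_ne_zero w one_ne_zero,
    Finsupp.weight_single, smul_eq_mul]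

/-- The bound `(n + 2)²` exceeds `(n + 1)(n + 3) = (n + 2)² - 1`, the weight of `yⁿ⁺¹`, so multiples
of `f` do not affect the lowest weights of `xⁿ⁺¹` and `yⁿ⁺¹`. -/
theorem le_weightedOrder_defPoly :
    ((n + 2) * (n + 2) : ℕ) ≤ MvPowerSeries.weightedOrder ![n + 2, n + 3] (defPoly k n) := by
  have h : ((n * (n + 2) : ℕ) : ℕ∞) ≤ MvPowerSeries.weightedOrder ![n + 2, n + 3]
      (MvPowerSeries.X 0 ^ n + MvPowerSeries.X 1 ^ n : MvPowerSeries (Fin 2) k) := by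
    refine le_trans (le_min ?_ ?_) (MvPowerSeries.min_weightedOrder_le_add _)
    · rw [MvPowerSeries.weightedOrder_X_pow]
      simp
    · rw [MvPowerSeries.weightedOrder_X_pow]
      exact Nat.cast_le.2 (Nat.mul_le_mul_left _ (by simp))
  have h0 := MvPowerSeries.weightedOrder_X_pow (R := k) ![n + 2, n + 3] 0 1
  have h1 := MvPowerSeries.weightedOrder_X_pow (R := k) ![n + 2, n + 3] 1 1
  rw [pow_one] at h0 h1
  rw [defPoly, MvPowerSeries.weightedOrder_mul, MvPowerSeries.weightedOrder_mul, h0, h1]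
  refine le_trans ?_ (add_le_add_right h _)
  norm_cast
  simp only [Matrix.cons_val_zero, Matrix.cons_val_one]
  nlinarith

/-- For the weights `(n + 2, n + 3)`, a common divisor of two power series with initial
monomials `x ^ (n + 1)` and `y ^ (n + 1)` is a unit. -/
theorem constantCoeff_ne_zero_of_mul_add {z a a' b b' g : MvPowerSeries (Fin 2) k}
    (hg : ((n + 2) * (n + 2) : ℕ) ≤ MvPowerSeries.weightedOrder ![n + 2, n + 3] g)
    (hx : MvPowerSeries.X 0 ^ (n + 1) = z * a + g * b)
    (hy : MvPowerSeries.X 1 ^ (n + 1) = z * a' + g * b') :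
    MvPowerSeries.constantCoeff z ≠ 0 := by
  have key : ∀ (i : Fin 2) (a b : MvPowerSeries (Fin 2) k),
      MvPowerSeries.X i ^ (n + 1) = z * a + g * b →
      MvPowerSeries.weightedOrder ![n + 2, n + 3] z +
        MvPowerSeries.weightedOrder ![n + 2, n + 3] a =
          ((n + 1) * (![n + 2, n + 3] : Fin 2 → ℕ) i : ℕ) := by
    intro i a b h
    have hX := MvPowerSeries.weightedOrder_X_pow (R := k) ![n + 2, n + 3] i (n + 1)
    have hlt : MvPowerSeries.weightedOrder ![n + 2, n + 3]
        (MvPowerSeries.X i ^ (n + 1) : MvPowerSeries (Fin 2) k) <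
        MvPowerSeries.weightedOrder ![n + 2, n + 3] (-(g * b)) := by
      rw [hX, MvPowerSeries.weightedOrder_neg, MvPowerSeries.weightedOrder_mul]
      refine lt_of_lt_of_le (lt_of_lt_of_le (Nat.cast_lt.2 ?_) hg) le_self_add
      fin_cases i
      · simp
      · simp
        nlinarith
    rw [← MvPowerSeries.weightedOrder_mul, ← hX, eq_sub_of_add_eq h.symm, sub_eq_add_neg,
      MvPowerSeries.weightedOrder_add_of_weightedOrder_ne _ hlt.ne, min_eq_left hlt.le]
  have h0 := key 0 a b hx
  have h1 := key 1 a' b' hy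
  have hfin : ∀ {u v : ℕ∞} {m : ℕ}, u + v = m → ∃ p q : ℕ, u = p ∧ v = q ∧ p + q = m := by
    intro u v m h
    have hu : u ≠ ⊤ := by rintro rfl; simp at h
    have hv : v ≠ ⊤ := by rintro rfl; simp at h
    lift u to ℕ using hu
    lift v to ℕ using hv
    exact ⟨u, v, rfl, rfl, by exact_mod_cast h⟩
  obtain ⟨p, q, hp, hq, hpq⟩ := hfin h0
  obtain ⟨p', q', hp', hq', hpq'⟩ := hfin h1
  obtain rfl : p = p' := by rw [hp] at hp'; exact_mod_cast hp'
  -- `d` is an exponent of lowest weight in `z`. With these weights, `(n + 1, 0)` and `(0, n + 1)`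
  -- are the only exponents of their weight, so `d + e` and `d + e'` are these two, and `d = 0`.
  obtain ⟨d, hd, hdw⟩ := MvPowerSeries.exists_coeff_ne_zero_of_weightedOrder_eq hp
  obtain ⟨e, -, hew⟩ := MvPowerSeries.exists_coeff_ne_zero_of_weightedOrder_eq hq
  obtain ⟨e', -, hew'⟩ := MvPowerSeries.exists_coeff_ne_zero_of_weightedOrder_eq hq'
  rw [weight_fin_two] at hdw hew hew'
  rw [← hdw, ← hew] at hpq
  rw [← hdw, ← hew'] at hpq'
  simp only [Matrix.cons_val_zero, Matrix.cons_val_one] at hpq hpq'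
  have hd1 : d 1 = 0 := by
    generalize d 0 = A, d 1 = B, e 0 = C, e 1 = D at hpq
    have h : (A + B + C + D) * (n + 2) + (B + D) = (n + 1) * (n + 2) := by linarith
    have hle : A + B + C + D ≤ n + 1 := by nlinarith
    have hm : (n + 2) ∣ B + D := by
      rw [Nat.dvd_iff_mod_eq_zero]
      have := congrArg (· % (n + 2)) h
      simpa [Nat.add_mod, Nat.mul_mod_left] using this
    have := Nat.eq_zero_of_dvd_of_lt hm (by omega)
    omega
  have hd0 : d 0 = 0 := by
    generalize d 0 = A, d 1 = B, e' 0 = C, e' 1 = D at hpq'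
    have h : (A + C) * (n + 2) + (B + D) * (n + 3) = (n + 1) * (n + 3) := by linarith
    have hle : B + D ≤ n + 1 := by nlinarith
    have h' : (A + C) * (n + 2) = (n + 1 - (B + D)) * (n + 3) := by
      obtain ⟨s, hs⟩ := Nat.exists_eq_add_of_le hle
      rw [hs, Nat.add_sub_cancel_left]
      rw [hs] at h
      nlinarith
    have hm : (n + 2) ∣ n + 1 - (B + D) := by
      refine (Nat.Coprime.dvd_mul_right (k := n + 2) (n := n + 3) ?_).1 ⟨A + C, by rw [← h']; ring⟩
      exact Nat.coprime_self_add_right.2 (Nat.coprime_one_right (n + 2))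
    have := Nat.eq_zero_of_dvd_of_lt hm (by omega)
    rw [this, zero_mul] at h'
    simp at h'
    exact h'.1
  have : d = 0 := by ext i; fin_cases i <;> simpa
  rwa [this, MvPowerSeries.coeff_zero_eq_constantCoeff_apply] at hd

theorem not_maximalIdeal_pow_le_span_singleton {z : HypersurfaceRing k n}
    (hz : z ∈ maximalIdeal (HypersurfaceRing k n)) :
    ¬ maximalIdeal (HypersurfaceRing k n) ^ (n + 1) ≤ Ideal.span {z} := by
  intro h
  obtain ⟨p, rfl⟩ := Ideal.Quotient.mk_surjective z
  have key : ∀ i : Fin 2, ∃ a b, (MvPowerSeries.X i : MvPowerSeries (Fin 2) k) ^ (n + 1) =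
      p * a + defPoly k n * b := by
    intro i
    have hi : (Ideal.Quotient.mk (Ideal.span {defPoly k n})) (MvPowerSeries.X i) ∈
        maximalIdeal (HypersurfaceRing k n) := (mk_mem_maximalIdeal_iff k n _).2 (by simp)
    have := h (Ideal.pow_mem_pow hi _)
    obtain ⟨r, hr⟩ := Ideal.mem_span_singleton.1 this
    obtain ⟨a, rfl⟩ := Ideal.Quotient.mk_surjective r
    rw [← map_pow, ← map_mul, Ideal.Quotient.eq, Ideal.mem_span_singleton] at hr
    obtain ⟨b, hb⟩ := hr
    exact ⟨a, b, by rw [← hb]; ring⟩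
  obtain ⟨a, b, hx⟩ := key 0
  obtain ⟨a', b', hy⟩ := key 1
  exact constantCoeff_ne_zero_of_mul_add le_weightedOrder_defPoly hx hy
    ((mk_mem_maximalIdeal_iff k n p).1 hz)

/-- `y` divides `f` but no power of `x`. Non-nilpotency of `x` is what excludes dimension zero. -/
theorem xBar_pow_ne_zero (j : ℕ) : xBar k n ^ j ≠ 0 := by
  intro h
  rw [xBar, ← map_pow, Ideal.Quotient.eq_zero_iff_mem, Ideal.mem_span_singleton] at h
  have h1 : (MvPowerSeries.X 1 : MvPowerSeries (Fin 2) k) ∣ MvPowerSeries.X 0 ^ j :=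
    (Dvd.intro_left _ rfl).mul_right _ |>.trans h
  rw [MvPowerSeries.X_dvd_iff] at h1
  have h2 := h1 (Finsupp.single 0 j) (by simp)
  rw [MvPowerSeries.coeff_X_pow] at h2
  simp at h2

/-! ### Krull dimension and generalized Loewy length. -/

theorem maximalIdeal_pow_le (h2 : ringChar k ≠ 2)
    (hchar : ¬ ((ringChar k : ℤ) ∣ 1 + (-2) ^ n)) :
    maximalIdeal (HypersurfaceRing k n) ^ (n + 2) ≤ Ideal.span {xBar k n + 2 * yBar k n} := by
  rw [maximalIdeal_pow_eq h2 hchar]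
  exact Ideal.mul_le_left

theorem radical_span_eq (h2 : ringChar k ≠ 2) (hchar : ¬ ((ringChar k : ℤ) ∣ 1 + (-2) ^ n)) :
    (Ideal.span {xBar k n + 2 * yBar k n}).radical = maximalIdeal (HypersurfaceRing k n) := by
  apply le_antisymm
  · refine (maximalIdeal.isMaximal (HypersurfaceRing k n)).isPrime.radical_le_iff.2 ?_
    rw [Ideal.span_singleton_le_iff_mem]
    exact xBar_add_two_mul_yBar_mem k n
  · intro r hr
    exact ⟨n + 2, maximalIdeal_pow_le h2 hchar (Ideal.pow_mem_pow hr _)⟩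

open Pointwise in
theorem ringKrullDim_hypersurfaceRing (h2 : ringChar k ≠ 2)
    (hchar : ¬ ((ringChar k : ℤ) ∣ 1 + (-2) ^ n)) :
    ringKrullDim (HypersurfaceRing k n) = 1 := by
  have hl := xBar_add_two_mul_yBar_mem k n
  have hrad := radical_span_eq h2 hchar
  set R := HypersurfaceRing k n
  set l : R := xBar k n + 2 * yBar k n
  have hle : ringKrullDim R ≤ 1 := by
    refine (ringKrullDim_le_ringKrullDim_quotSMulTop_succ hl).trans ?_
    have h0 : Ring.KrullDimLE 0 (R ⧸ l • (⊤ : Ideal R)) := by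
      have : l • (⊤ : Ideal R) = Ideal.span {l} := by
        rw [← Submodule.ideal_span_singleton_smul, smul_eq_mul, Ideal.mul_top]
      rw [this, Ideal.krullDimLE_zero_quotient_iff_forall_minimalPrimes_isMaximal]
      intro J hJ
      have hJp : J.IsPrime := hJ.1.1
      have hJm : maximalIdeal R ≤ J := hrad ▸ hJp.radical_le_iff.2 hJ.1.2
      rw [← (maximalIdeal.isMaximal R).eq_of_le hJp.ne_top hJm]
      exact maximalIdeal.isMaximal R
    rw [Ring.krullDimLE_iff] at h0
    calc _ ≤ ((0 : ℕ) : WithBot ℕ∞) + 1 := by gcongr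
      _ = 1 := by simp
  by_contra hne
  have h0 : Ring.KrullDimLE 0 R := by
    rw [Ring.krullDimLE_iff]
    have hlt := lt_of_le_of_ne hle hne
    generalize ringKrullDim R = d at hlt
    induction d with
    | bot => exact bot_le
    | coe d =>
      have : d < 1 := by exact_mod_cast hlt
      rw [Order.lt_one_iff.1 this]
      simp
  obtain ⟨j, hj⟩ := (Ring.KrullDimLE.isNilpotent_iff_mem_maximalIdeal (R := R)).2 (xBar_mem k n)
  exact xBar_pow_ne_zero j hj

theorem generalizedLoewyLength_hypersurfaceRing (h2 : ringChar k ≠ 2)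
    (hchar : ¬ ((ringChar k : ℤ) ∣ 1 + (-2) ^ n)) :
    generalizedLoewyLength (HypersurfaceRing k n) = ((n + 2 : ℕ) : ℕ∞) := by
  have hdim := ringKrullDim_hypersurfaceRing h2 hchar
  apply le_antisymm
  · refine iInf₂_le (n + 2) ⟨by omega, 1, fun _ => xBar k n + 2 * yBar k n, ⟨?_, ?_⟩, ?_⟩
    · rw [hdim]; rfl
    · rw [Set.range_const, radical_span_eq h2 hchar]
    · rw [Set.range_const]
      exact maximalIdeal_pow_le h2 hchar
  · refine le_iInf₂ fun j hj => ?_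
    obtain ⟨-, d, z, ⟨hd, hz⟩, hle⟩ := hj
    obtain rfl : d = 1 := by rw [hdim] at hd; exact_mod_cast hd
    have hr : Set.range z = {z 0} := by
      exact Set.range_unique
    rw [hr] at hz hle
    have hmem : z 0 ∈ maximalIdeal (HypersurfaceRing k n) := by
      rw [← hz]
      exact Ideal.le_radical (Ideal.mem_span_singleton_self _)
    by_contra! hlt
    have hlt' : j < n + 2 := Nat.cast_lt.1 hlt
    exact not_maximalIdeal_pow_le_span_singleton hmem
      ((Ideal.pow_le_pow_right (by omega)).trans hle)

/-! ### Surjections onto `R` from torsion-free modules. -/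

theorem exists_sum_range_of_fin {A R : Type*} [CommRing A] [CommRing R] [Algebra A R] {y r : R}
    {N : ℕ} (h : ∃ c : Fin N → A, r = ∑ i, c i • y ^ (i : ℕ)) :
    ∃ c : ℕ → A, r = ∑ i ∈ Finset.range N, c i • y ^ i := by
  obtain ⟨c, rfl⟩ := h
  refine ⟨fun i => if h : i < N then c ⟨i, h⟩ else 0, ?_⟩
  rw [← Fin.sum_univ_eq_sum_range (fun i => (if h : i < N then c ⟨i, h⟩ else 0) • y ^ i)]
  simp

/-- Let `R` be spanned by `1, y, …, y ^ M` over a discrete valuation ring `A` with uniformizer `t`,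
with `y ^ (M + 1)` in `t R`. A finite `R`-module which is torsion-free over `A` maps onto `R` as soon
as it has an element `e` with `y ^ M e` not divisible by `t`. -/
theorem exists_surjective_of_isTorsionFree {A R X : Type*} [CommRing A] [IsDomain A]
    [IsPrincipalIdealRing A] [IsLocalRing A] [CommRing R] [IsLocalRing R] [Algebra A R]
    [AddCommGroup X] [Module A X] [Module R X] [IsScalarTower A R X] [Module.Finite A X]
    [Module.IsTorsionFree A X] {t : A} (ht : maximalIdeal A = Ideal.span {t}) {y : R}
    (hy : y ∈ maximalIdeal R) {M : ℕ}
    (hspan : ∀ r : R, ∃ c : Fin (M + 1) → A, r = ∑ i, c i • y ^ (i : ℕ))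
    (hyM : ∃ s, y ^ (M + 1) = t • s) {e : X} (he : ¬ ∃ v : X, y ^ M • e = t • v) :
    ∃ Φ : X →ₗ[R] R, Function.Surjective Φ := by
  obtain ⟨s, hs⟩ := hyM
  obtain ⟨c, hc⟩ := exists_sum_range_of_fin (hspan s)
  have hpow : y ^ (M + 1) = ∑ i ∈ Finset.range (M + 1), (t * c i) • y ^ i := by
    simp only [hs, hc, Finset.smul_sum, smul_smul]
  -- The Horner quotients at `y` of the monic relation `hpow`: terms of degree below `i` are dropped
  -- and the rest is divided by `y ^ i`.
  let g : ℕ → R := fun i => y ^ (M + 1 - i) - ∑ j ∈ Finset.Ico i (M + 1), (t * c j) • y ^ (j - i)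
  have hg0 : g 0 = 0 := by
    simp only [g, Nat.sub_zero, hpow, Finset.range_eq_Ico, sub_self]
  have hgN : g (M + 1) = 1 := by simp [g]
  have hg : ∀ i < M + 1, y * g (i + 1) = g i + algebraMap A R (t * c i) := by
    intro i hi
    simp only [g]
    rw [Finset.sum_eq_sum_Ico_succ_bot hi, mul_sub, ← pow_succ', Finset.mul_sum,
      show M + 1 - (i + 1) + 1 = M + 1 - i by omega, Nat.sub_self, pow_zero,
      ← Algebra.algebraMap_eq_smul_one]
    have : ∀ j ∈ Finset.Ico (i + 1) (M + 1), y * (t * c j) • y ^ (j - (i + 1)) =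
        (t * c j) • y ^ (j - i) := by
      intro j hj
      rw [mul_smul_comm, ← pow_succ', show j - (i + 1) + 1 = j - i by
        have := Finset.mem_Ico.1 hj; omega]
    rw [Finset.sum_congr rfl this]
    abel
  let b := Module.Free.chooseBasis A X
  obtain ⟨i, hi⟩ : ∃ i, b.repr (y ^ M • e) i ∉ maximalIdeal A := by
    by_contra! hcon
    rw [ht] at hcon
    choose d hd using fun i => Ideal.mem_span_singleton.1 (hcon i)
    refine he ⟨∑ i, d i • b i, ?_⟩
    conv_lhs => rw [← b.sum_repr (y ^ M • e)]
    simp only [hd, Finset.smul_sum, smul_smul]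
  obtain ⟨Φ, hΦ⟩ := exists_linearMap_eq_sum y (M + 1) (fun i => t * c i) g hg0 hgN hg hpow hspan
    (b.coord i)
  have hg1 : g 1 = y ^ M - t • ∑ j ∈ Finset.Ico 1 (M + 1), c j • y ^ (j - 1) := by
    simp only [g, Nat.add_sub_cancel, Finset.smul_sum, smul_smul]
  -- `g 1` agrees with `y ^ M` modulo `t`, so this coordinate is a unit together with that of `y ^ M
  -- • e`.
  have hu : IsUnit (b.coord i (g 1 • e)) := by
    by_contra hnu
    refine hi ?_
    have h1 : b.coord i (g 1 • e) ∈ maximalIdeal A := hnu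
    rw [hg1, sub_smul, map_sub, smul_assoc, map_smul (b.coord i) t, smul_eq_mul] at h1
    refine (Submodule.sub_mem_iff_left _ ?_).1 h1
    rw [ht]
    exact Ideal.mul_mem_right _ _ (Ideal.mem_span_singleton_self t)
  -- All terms of `Φ e` except the one with `y ^ 0` lie in the maximal ideal.
  have hunit : IsUnit (Φ e) := by
    by_contra hnu
    have h1 : Φ e ∈ maximalIdeal R := hnu
    rw [hΦ, Finset.sum_range_succ', pow_zero, ← Algebra.algebraMap_eq_smul_one] at h1
    have h2 : ∑ i_1 ∈ Finset.range M, b.coord i (g (i_1 + 1 + 1) • e) • y ^ (i_1 + 1) ∈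
        maximalIdeal R := by
      refine Ideal.sum_mem _ fun j _ => ?_
      rw [Algebra.smul_def, pow_succ]
      exact Ideal.mul_mem_left _ _ (Ideal.mul_mem_left _ _ hy)
    exact (add_mem_cancel_left h2).1 h1 (hu.map (algebraMap A R))
  obtain ⟨w, hw⟩ := hunit.exists_left_inv
  exact ⟨Φ, fun r => ⟨(r * w) • e, by rw [map_smul, smul_eq_mul, mul_assoc, hw, mul_one]⟩⟩

/-! ### The ring as a finite algebra over `k⟦t⟧`. -/

theorem hasSubst_X_add_two_mul_X :
    PowerSeries.HasSubst (MvPowerSeries.X 0 + 2 * MvPowerSeries.X 1 : MvPowerSeries (Fin 2) k) :=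
  PowerSeries.HasSubst.of_constantCoeff_zero (by simp)

variable (k n) in
/-- The `k`-algebra homomorphism `k⟦t⟧ → k⟦x, y⟧ / (xy(xⁿ + yⁿ))` with `t ↦ x + 2y`. -/
noncomputable def paramHom : PowerSeries k →ₐ[k] HypersurfaceRing k n :=
  (Ideal.Quotient.mkₐ k (Ideal.span {defPoly k n})).comp
    (PowerSeries.substAlgHom hasSubst_X_add_two_mul_X)

theorem paramHom_X : paramHom k n PowerSeries.X = xBar k n + 2 * yBar k n := by
  rw [paramHom, AlgHom.comp_apply, PowerSeries.substAlgHom_X, map_add, map_mul, map_ofNat]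
  rfl

theorem exists_eq_algebraMap_add (r : HypersurfaceRing k n) :
    ∃ (c : k) (a b : HypersurfaceRing k n),
      r = algebraMap k _ c + (xBar k n + 2 * yBar k n) * a + yBar k n * b := by
  obtain ⟨p, rfl⟩ := Ideal.Quotient.mk_surjective r
  obtain ⟨a, b, h⟩ := MvPowerSeries.exists_eq_X_mul_add_X_mul
    (p - MvPowerSeries.C (MvPowerSeries.constantCoeff p)) (by simp)
  refine ⟨MvPowerSeries.constantCoeff p, Ideal.Quotient.mk _ a,
    Ideal.Quotient.mk _ b - 2 * Ideal.Quotient.mk _ a, ?_⟩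
  have h' := congrArg (Ideal.Quotient.mk (Ideal.span {defPoly k n})) (sub_eq_iff_eq_add.1 h)
  rw [h', map_add, map_add, map_mul, map_mul]
  change xBar k n * _ + yBar k n * _ + algebraMap k (HypersurfaceRing k n) _ = _
  ring

theorem exists_eq_sum_add (j : ℕ) (r : HypersurfaceRing k n) :
    ∃ (c : Fin j → PowerSeries k) (a b : HypersurfaceRing k n),
      r = ∑ i, paramHom k n (c i) * yBar k n ^ (i : ℕ) + (xBar k n + 2 * yBar k n) * a +
        yBar k n ^ j * b := by
  induction j with
  | zero => exact ⟨0, 0, r, by simp⟩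
  | succ j ih =>
    obtain ⟨c, a, b, h⟩ := ih
    obtain ⟨d, a', b', rfl⟩ := exists_eq_algebraMap_add b
    refine ⟨Fin.snoc c (algebraMap k _ d), a + yBar k n ^ j * a', b', ?_⟩
    rw [Fin.sum_univ_castSucc, h]
    simp only [Fin.snoc_castSucc, Fin.snoc_last, Fin.val_castSucc, Fin.val_last, AlgHom.commutes]
    ring

/-- Modulo `l` the powers of `y` below `n + 2` suffice, since `yⁿ⁺² ∈ (l)`; completeness of `k⟦t⟧`
and `l`-adic separatedness of the local ring `R` lift this to `R`. -/
theorem exists_eq_sum_paramHom (h2 : ringChar k ≠ 2)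
    (hchar : ¬ ((ringChar k : ℤ) ∣ 1 + (-2) ^ n)) (r : HypersurfaceRing k n) :
    ∃ c : Fin (n + 2) → PowerSeries k,
      r = ∑ i, paramHom k n (c i) * yBar k n ^ (i : ℕ) := by
  let _ : Algebra (PowerSeries k) (HypersurfaceRing k n) := (paramHom k n).toRingHom.toAlgebra
  have hmap : algebraMap (PowerSeries k) (HypersurfaceRing k n) PowerSeries.X =
    xBar k n + 2 * yBar k n := paramHom_X
  have hH : IsHausdorff (Ideal.span {(PowerSeries.X : PowerSeries k)}) (HypersurfaceRing k n) := by
    rw [← IsHausdorff.map_algebraMap_iff (S := HypersurfaceRing k n), Ideal.map_span,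
      Set.image_singleton, hmap]
    refine IsHausdorff.of_isLocalRing _ _ fun htop => ?_
    exact (maximalIdeal.isMaximal (HypersurfaceRing k n)).ne_top (top_le_iff.1 (htop ▸
      (Ideal.span_singleton_le_iff_mem _).2 (xBar_add_two_mul_yBar_mem k n)))
  refine exists_eq_sum_smul_pow_of_mod (PowerSeries.X : PowerSeries k) (yBar k n) (n + 2)
    (fun r => ?_) r
  obtain ⟨c, a, b, h⟩ := exists_eq_sum_add (n + 2) r
  obtain ⟨s, hs⟩ := Ideal.mem_span_singleton.1
    (maximalIdeal_pow_le h2 hchar (Ideal.pow_mem_pow (yBar_mem k n) (n + 2)))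
  refine ⟨c, a + s * b, ?_⟩
  rw [Algebra.smul_def, hmap, h, hs]
  simp only [Algebra.smul_def]
  change _ = ∑ i, paramHom k n (c i) * _ + _
  ring

/-! ### The module `R/(y(xⁿ + yⁿ))` and the vanishing of delta. -/

theorem MvPowerSeries.prime_X_zero : Prime (MvPowerSeries.X 0 : MvPowerSeries (Fin 2) k) := by
  have : IsDomain (MvPowerSeries (Fin 1) k) := NoZeroDivisors.to_isDomain _
  have h : Prime (MvPowerSeries.finSuccEquiv k 1 (MvPowerSeries.X 0)) := by
    rw [MvPowerSeries.finSuccEquiv_X_zero]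
    exact PowerSeries.X_prime
  exact (MulEquiv.prime_iff (MvPowerSeries.finSuccEquiv k 1)).1 h

theorem not_X_zero_dvd (hn : 1 ≤ n) : ¬ (MvPowerSeries.X 0 : MvPowerSeries (Fin 2) k) ∣
    MvPowerSeries.X 1 * (MvPowerSeries.X 0 ^ n + MvPowerSeries.X 1 ^ n) := by
  rw [mul_add, ← pow_succ', dvd_add_right (Dvd.dvd.mul_left (dvd_pow_self _ (by omega)) _)]
  intro h
  have h2 := MvPowerSeries.X_dvd_iff.1 h (Finsupp.single 1 (n + 1)) (by simp)
  rw [MvPowerSeries.coeff_X_pow] at h2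
  simp at h2

theorem yBar_mul_ne_zero (hn : 1 ≤ n) : yBar k n * (xBar k n ^ n + yBar k n ^ n) ≠ 0 := by
  intro h
  rw [xBar, yBar, ← map_pow, ← map_pow, ← map_add, ← map_mul, Ideal.Quotient.eq_zero_iff_mem,
    Ideal.mem_span_singleton] at h
  refine not_X_zero_dvd (k := k) hn (dvd_trans ?_ h)
  rw [defPoly, mul_assoc]
  exact dvd_mul_right _ _

/-- Since `x` is prime in `k⟦x, y⟧` and does not divide `y(xⁿ + yⁿ)`, it can be cancelled. Hence `x`
is regular on the quotient. -/
theorem mem_span_of_xBar_mul_mem (hn : 1 ≤ n) {r : HypersurfaceRing k n}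
    (h : xBar k n * r ∈ Ideal.span {yBar k n * (xBar k n ^ n + yBar k n ^ n)}) :
    r ∈ Ideal.span {yBar k n * (xBar k n ^ n + yBar k n ^ n)} := by
  obtain ⟨p, rfl⟩ := Ideal.Quotient.mk_surjective r
  obtain ⟨q, hq⟩ := Ideal.mem_span_singleton.1 h
  obtain ⟨q, rfl⟩ := Ideal.Quotient.mk_surjective q
  rw [xBar, yBar, ← map_pow, ← map_pow, ← map_add, ← map_mul, ← map_mul, ← map_mul,
    Ideal.Quotient.eq, Ideal.mem_span_singleton] at hq
  obtain ⟨s, hs⟩ := hq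
  have h1 : MvPowerSeries.X 0 * p = MvPowerSeries.X 1 *
      (MvPowerSeries.X 0 ^ n + MvPowerSeries.X 1 ^ n) * (q + MvPowerSeries.X 0 * s) := by
    rw [sub_eq_iff_eq_add.1 hs, defPoly]
    ring
  obtain ⟨w, hw⟩ := (MvPowerSeries.prime_X_zero.dvd_or_dvd ⟨p, h1.symm⟩).resolve_left
    (not_X_zero_dvd hn)
  rw [hw, mul_left_comm] at h1
  have h2 := mul_left_cancel₀ MvPowerSeries.prime_X_zero.ne_zero h1
  rw [Ideal.mem_span_singleton, h2]
  refine ⟨Ideal.Quotient.mk _ w, ?_⟩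
  rw [xBar, yBar, map_mul, map_mul, map_add, map_pow, map_pow]

theorem isMaximalCohenMacaulay_quotient (hn : 1 ≤ n) (h2 : ringChar k ≠ 2)
    (hchar : ¬ ((ringChar k : ℤ) ∣ 1 + (-2) ^ n)) :
    IsMaximalCohenMacaulay (HypersurfaceRing k n)
      (HypersurfaceRing k n ⧸
        Ideal.span {yBar k n * (xBar k n ^ n + yBar k n ^ n)}) := by
  refine ⟨inferInstance, Or.inr ⟨[xBar k n], by simpa using xBar_mem k n, ?_, ?_⟩⟩
  · have : Nontrivial (HypersurfaceRing k n ⧸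
        Ideal.span {yBar k n * (xBar k n ^ n + yBar k n ^ n)}) := by
      refine Ideal.Quotient.nontrivial_iff.2 fun h => ?_
      refine (maximalIdeal.isMaximal (HypersurfaceRing k n)).ne_top (top_le_iff.1 (h ▸ ?_))
      exact (Ideal.span_singleton_le_iff_mem _).2 (Ideal.mul_mem_right _ _ (yBar_mem k n))
    rw [IsLocalRing.isRegular_iff_isWeaklyRegular_of_subset_maximalIdeal
      (by simpa using xBar_mem k n)]
    rw [RingTheory.Sequence.isWeaklyRegular_singleton_iff,
      isSMulRegular_iff_right_eq_zero_of_smul]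
    intro v hv
    obtain ⟨r, rfl⟩ := Ideal.Quotient.mk_surjective v
    change Ideal.Quotient.mk _ (xBar k n * r) = 0 at hv
    exact Ideal.Quotient.eq_zero_iff_mem.2
      (mem_span_of_xBar_mul_mem hn (Ideal.Quotient.eq_zero_iff_mem.1 hv))
  · rw [ringKrullDim_hypersurfaceRing h2 hchar]
    rfl

theorem auslanderDelta_eq_zero (hn : 1 ≤ n) (h2 : ringChar k ≠ 2)
    (hchar : ¬ ((ringChar k : ℤ) ∣ 1 + (-2) ^ n)) {j : ℕ} (hj : j ≤ n + 1) :
    auslanderDelta (HypersurfaceRing k n)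
      (HypersurfaceRing k n ⧸ maximalIdeal (HypersurfaceRing k n) ^ j) = 0 := by
  refine Nat.sInf_eq_zero.2 (Or.inl ⟨_, inferInstance, inferInstance,
    isMaximalCohenMacaulay_quotient hn h2 hchar,
    hasNoFreeSummand_of_smul_eq_zero (yBar_mul_ne_zero hn) fun v => ?_, ?_⟩)
  · obtain ⟨r, rfl⟩ := Ideal.Quotient.mk_surjective v
    change Ideal.Quotient.mk _ (yBar k n * (xBar k n ^ n + yBar k n ^ n) * r) = 0
    exact Ideal.Quotient.eq_zero_iff_mem.2
      (Ideal.mul_mem_right _ _ (Ideal.mem_span_singleton_self _))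
  · have hle : Ideal.span {yBar k n * (xBar k n ^ n + yBar k n ^ n)} ≤
        maximalIdeal (HypersurfaceRing k n) ^ j := by
      refine le_trans ?_ (Ideal.pow_le_pow_right hj)
      rw [Ideal.span_singleton_le_iff_mem, pow_succ' (maximalIdeal (HypersurfaceRing k n))]
      exact Ideal.mul_mem_mul (yBar_mem k n) (add_mem (Ideal.pow_mem_pow (xBar_mem k n) n)
        (Ideal.pow_mem_pow (yBar_mem k n) n))
    refine ⟨(Ideal.Quotient.factorₐ (HypersurfaceRing k n) hle).toLinearMap.comp
      (LinearMap.fst _ _ _), ?_⟩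
    exact (Ideal.Quotient.factor_surjective hle).comp Prod.fst_surjective

/-! ### Delta of `R/mⁿ⁺²` and the index. -/

/-- On a maximal Cohen-Macaulay module, a parameter is a nonzerodivisor. -/
theorem eq_zero_of_smul_eq_zero (h2 : ringChar k ≠ 2)
    (hchar : ¬ ((ringChar k : ℤ) ∣ 1 + (-2) ^ n)) {X : Type v} [AddCommGroup X]
    [Module (HypersurfaceRing k n) X] (hX : IsMaximalCohenMacaulay (HypersurfaceRing k n) X)
    {v : X} (hv : (xBar k n + 2 * yBar k n) • v = 0) : v = 0 := by
  obtain ⟨-, h | ⟨rs, hrs, hreg, hlen⟩⟩ := hX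
  · exact Subsingleton.elim _ _
  · rw [ringKrullDim_hypersurfaceRing h2 hchar] at hlen
    obtain ⟨r, rfl⟩ := List.length_eq_one_iff.1 (by exact_mod_cast hlen)
    have hr := (RingTheory.Sequence.isWeaklyRegular_singleton_iff X r).1 hreg.toIsWeaklyRegular
    -- `r ^ (n + 2)` is a multiple of `l`, so an element killed by `l` is killed by a power of the
    -- regular element `r`.
    obtain ⟨s, hs⟩ := Ideal.mem_span_singleton.1
      (maximalIdeal_pow_le h2 hchar (Ideal.pow_mem_pow (hrs r (by simp)) (n + 2)))
    refine (hr.pow (n + 2)).right_eq_zero_of_smul ?_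
    rw [hs, mul_comm, mul_smul, hv, smul_zero]

theorem not_hasNoFreeSummand_of_isMaximalCohenMacaulay (h2 : ringChar k ≠ 2)
    (hchar : ¬ ((ringChar k : ℤ) ∣ 1 + (-2) ^ n)) {X : Type v} [AddCommGroup X]
    [Module (HypersurfaceRing k n) X] (hX : IsMaximalCohenMacaulay (HypersurfaceRing k n) X)
    (φ : X →ₗ[HypersurfaceRing k n]
      HypersurfaceRing k n ⧸ maximalIdeal (HypersurfaceRing k n) ^ (n + 2))
    (hφ : Function.Surjective φ) : ¬ HasNoFreeSummand (HypersurfaceRing k n) X := by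
  let _ : Algebra (PowerSeries k) (HypersurfaceRing k n) := (paramHom k n).toRingHom.toAlgebra
  let _ : Module (PowerSeries k) X := Module.compHom X (paramHom k n).toRingHom
  have : IsScalarTower (PowerSeries k) (HypersurfaceRing k n) X :=
    ⟨fun a r v => by rw [Algebra.smul_def, mul_smul]; rfl⟩
  have hmap : algebraMap (PowerSeries k) (HypersurfaceRing k n) PowerSeries.X =
    xBar k n + 2 * yBar k n := paramHom_X
  have hsmul : ∀ v : X, (PowerSeries.X : PowerSeries k) • v = (xBar k n + 2 * yBar k n) • v :=
    fun v => by rw [← hmap, algebraMap_smul]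
  have hspan : ∀ r : HypersurfaceRing k n, ∃ c : Fin (n + 1 + 1) → PowerSeries k,
      r = ∑ i, c i • yBar k n ^ (i : ℕ) := fun r => by
    simp only [Algebra.smul_def]
    exact exists_eq_sum_paramHom h2 hchar r
  have hfin : Module.Finite (PowerSeries k) (HypersurfaceRing k n) := by
    refine Module.Finite.of_surjective
      (Fintype.linearCombination (PowerSeries k) fun i : Fin (n + 2) => yBar k n ^ (i : ℕ))
      fun r => ?_
    obtain ⟨c, hc⟩ := hspan r
    exact ⟨c, by rw [hc, Fintype.linearCombination_apply]⟩
  have hfinX : Module.Finite (HypersurfaceRing k n) X := hX.1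
  have : Module.Finite (PowerSeries k) X := Module.Finite.trans (HypersurfaceRing k n) X
  have : Module.IsTorsionFree (PowerSeries k) X := by
    refine ⟨fun a ha => ?_⟩
    -- In a discrete valuation ring it is enough to see that the uniformizer, acting as `l`, is
    -- regular on `X`.
    obtain ⟨m, w, rfl⟩ := IsDiscreteValuationRing.eq_unit_mul_pow_irreducible ha.ne_zero
      (PowerSeries.X_irreducible (R := k))
    refine (w.isUnit.isSMulRegular X).mul (IsSMulRegular.pow m ?_)
    rw [isSMulRegular_iff_right_eq_zero_of_smul]
    exact fun v hv => eq_zero_of_smul_eq_zero h2 hchar hX ((hsmul v).symm.trans hv)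
  obtain ⟨e, he⟩ := hφ (Ideal.Quotient.mk _ 1)
  obtain ⟨s, hs⟩ := Ideal.mem_span_singleton.1
    (maximalIdeal_pow_le h2 hchar (Ideal.pow_mem_pow (yBar_mem k n) (n + 2)))
  have hdvd : ¬ ∃ v : X, yBar k n ^ (n + 1) • e = (PowerSeries.X : PowerSeries k) • v := by
    rintro ⟨v, hv⟩
    rw [hsmul] at hv
    have h := congrArg φ hv
    obtain ⟨r, hr⟩ := Ideal.Quotient.mk_surjective (φ v)
    rw [map_smul, map_smul, he, ← hr] at h
    change Ideal.Quotient.mk _ (yBar k n ^ (n + 1) * 1) =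
      Ideal.Quotient.mk _ ((xBar k n + 2 * yBar k n) * r) at h
    rw [mul_one, Ideal.Quotient.eq] at h
    -- The error term lies in `mⁿ⁺²`, hence itself in `(l)`.
    have hy : yBar k n ^ (n + 1) ∈ Ideal.span {xBar k n + 2 * yBar k n} := by
      refine (Submodule.sub_mem_iff_left _ ?_).1 (maximalIdeal_pow_le h2 hchar h)
      exact Ideal.mul_mem_right _ _ (Ideal.mem_span_singleton_self _)
    refine not_maximalIdeal_pow_le_span_singleton (xBar_add_two_mul_yBar_mem k n) ?_
    have hle := span_pair_pow_succ_le (xBar k n + 2 * yBar k n) (yBar k n) n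
    rw [← maximalIdeal_eq_span'] at hle
    exact hle.trans (sup_le Ideal.mul_le_left ((Ideal.span_singleton_le_iff_mem _).2 hy))
  obtain ⟨Φ, hΦ⟩ := exists_surjective_of_isTorsionFree
    (PowerSeries.maximalIdeal_eq_span_X (k := k)) (yBar_mem k n) hspan
    ⟨s, by rw [Algebra.smul_def, hmap, ← hs]⟩ hdvd
  exact not_hasNoFreeSummand_of_surjective Φ hΦ

theorem auslanderDelta_eq_one (h2 : ringChar k ≠ 2)
    (hchar : ¬ ((ringChar k : ℤ) ∣ 1 + (-2) ^ n)) :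
    auslanderDelta (HypersurfaceRing k n)
      (HypersurfaceRing k n ⧸ maximalIdeal (HypersurfaceRing k n) ^ (n + 2)) = 1 := by
  have hmem : 1 ∈ {m : ℕ | ∃ (X : Type u) (_ : AddCommGroup X)
      (_ : Module (HypersurfaceRing k n) X),
      IsMaximalCohenMacaulay (HypersurfaceRing k n) X ∧
      HasNoFreeSummand (HypersurfaceRing k n) X ∧
      ∃ φ : (X × (Fin m → HypersurfaceRing k n)) →ₗ[HypersurfaceRing k n]
        (HypersurfaceRing k n ⧸ maximalIdeal (HypersurfaceRing k n) ^ (n + 2)),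
        Function.Surjective φ} := by
    refine ⟨PUnit, inferInstance, inferInstance, ⟨inferInstance, Or.inl inferInstance⟩,
      fun N _ _ _ => Subsingleton.elim _ _,
      (Ideal.Quotient.mkₐ (HypersurfaceRing k n) _).toLinearMap.comp
        ((LinearMap.proj 0).comp (LinearMap.snd _ _ _)), ?_⟩
    exact Ideal.Quotient.mk_surjective.comp
      ((Function.surjective_eval 0).comp Prod.snd_surjective)
  refine le_antisymm (Nat.sInf_le hmem) (Nat.one_le_iff_ne_zero.2 fun h0 => ?_)
  -- An infimum `0` could also be the default value on the empty set; `hmem`, obtained from `X = 0`,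
  -- rules this out.
  rcases Nat.sInf_eq_zero.1 h0 with ⟨X, _, _, hX, hfree, φ, hφ⟩ | he
  · refine not_hasNoFreeSummand_of_isMaximalCohenMacaulay h2 hchar hX
      (φ.comp (LinearMap.inl _ _ _)) (fun w => ?_) hfree
    obtain ⟨⟨v, z⟩, rfl⟩ := hφ w
    exact ⟨v, by rw [Subsingleton.elim z 0]; rfl⟩
  · rw [he] at hmem
    exact hmem

theorem auslanderIndex_hypersurfaceRing (hn : 1 ≤ n) (h2 : ringChar k ≠ 2)
    (hchar : ¬ ((ringChar k : ℤ) ∣ 1 + (-2) ^ n)) :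
    auslanderIndex (HypersurfaceRing k n) = ((n + 2 : ℕ) : ℕ∞) := by
  refine le_antisymm (iInf₂_le (n + 2) ⟨by omega, auslanderDelta_eq_one h2 hchar⟩)
    (le_iInf₂ fun j hj => ?_)
  by_contra! hlt
  have hlt' : j < n + 2 := Nat.cast_lt.1 hlt
  have h := hj.2
  rw [auslanderDelta_eq_zero hn h2 hchar (by omega)] at h
  exact zero_ne_one h

end HypersurfaceRing

theorem proposition3p7 (n : ℕ) (hn : 1 ≤ n) (k : Type u) [Field k]
    (h2 : ringChar k ≠ 2) (hchar : ¬ ((ringChar k : ℤ) ∣ 1 + (-2) ^ n)) :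
    maximalIdeal (HypersurfaceRing k n) ^ (n + 2) =
        Ideal.span {xBar k n + 2 * yBar k n} * maximalIdeal (HypersurfaceRing k n) ^ (n + 1) ∧
      generalizedLoewyLength (HypersurfaceRing k n) = ((n + 2 : ℕ) : ℕ∞) ∧
      auslanderIndex (HypersurfaceRing k n) = ((n + 2 : ℕ) : ℕ∞) :=
  ⟨maximalIdeal_pow_eq h2 hchar, generalizedLoewyLength_hypersurfaceRing h2 hchar,
    auslanderIndex_hypersurfaceRing hn h2 hchar⟩
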